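/- Let $\mathcal H$ be a separable complex Hilbert space and let $\mathcal O$ be the category whose objects are the bounded self-adjoint operators on $\mathcal H$, with a (unique) morphism $f_{\mathcal O}:B\to A$ whenever $B=f(A)$ for some bounded Borel function $f$ (two functions $f,g$ being identified if $f(A)=g(A)$). For $\Delta$ a Borel subset of the spectrum $\sigma(A)$ let $E[A\in\Delta]$ be the spectral projector, let $W_A=\{E[A\in\Delta]\mid \Delta\subseteq\sigma(A)\text{ Borel}\}$, and for $f_{\mathcal O}:B\to A$ define $$E[B\in f(\Delta)]:=\inf\{E[B\in K]\mid K\subseteq\sigma(B)\text{ Borel},\ E[A\in\Delta]\le E[B\in K]\},$$ the infimum being taken in the lattice of all projectors on $\mathcal H$. A generalized valuation $\nu$ assigns to each proposition "$A\in\Delta$" ($A\in\mathcal O$, $\Delta\subseteq\sigma(A)$ Borel) a sieve $\nu(A\in\Delta)$ on $A$ in $\mathcal O$, depending only on $A$ and the projector $E[A\in\Delta]$, such that: (i) functional composition: for every $h_{\mathcal O}:h(A)\to A$ the projector $E[h(A)\in h(\Delta)]$ belongs to $W_{h(A)}$, and $\nu(h(A)\in h(\Delta))=h_{\mathcal O}^*(\nu(A\in\Delta))$,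 where the left side is $\nu(h(A)\in J)$ for any Borel $J\subseteq\sigma(h(A))$ with $E[h(A)\in J]=E[h(A)\in h(\Delta)]$, and $h_{\mathcal O}^*$ is the pull-back of sieves; (ii) null proposition: $\nu(A\in\emptyset)=\emptyset$; (iii) monotonicity: $\Delta_1\subseteq\Delta_2$ implies $\nu(A\in\Delta_1)\subseteq\nu(A\in\Delta_2)$; (iv) exclusivity: if $\Delta_1\cap\Delta_2=\emptyset$ and $\nu(A\in\Delta_1)$ is the principal sieve $\mathrm{true}_A$ of all morphisms into $A$, then $\nu(A\in\Delta_2)\subsetneq\mathrm{true}_A$. It satisfies the unit condition if $\nu(A\in\sigma(A))=\mathrm{true}_A$ for all $A$. Theorem. (a) For every density matrix $\rho$ (positive operator of trace $1$) the set $$\nu^\rho(A\in\Delta)=\{f_{\mathcal O}:B\to A\mid \operatorname{tr}(\rho\,E[B\in f(\Delta)])=1\}$$ is a sieve on $A$ in $\mathcal O$, and $\nu^\rho$ is a generalized valuation that satisfies the unit condition. (b) For every non-zero vector $\psi\in\mathcal H$ the set $$\nu^\psi(A\in\Delta)=\{f_{\mathcal O}:B\to A\mid E[B\in f(\Delta)]\psi=\psi\}$$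 is a sieve on $A$, $\nu^\psi$ is a generalized valuation that satisfies the unit condition, and $\nu^\psi=\nu^{\rho}$ for the density matrix $\rho=\|\psi\|^{-2}|\psi\rangle\langle\psi|$. Both valuations also satisfy the conditions in contextual form, as maps $\nu_A:W_A\to\{\text{sieves on }A\}$, $\nu_A(E[A\in\Delta])=\nu(A\in\Delta)$: functional composition; $\nu_A(0)=\emptyset$; $P\le Q$ implies $\nu_A(P)\subseteq\nu_A(Q)$; if $PQ=0$ and $\nu_A(P)=\mathrm{true}_A$ then $\nu_A(Q)\subsetneq\mathrm{true}_A$; $\nu_A(1)=\mathrm{true}_A$. -/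

import Mathlib

universe u

namespace GenVal

open MeasureTheory CategoryTheory InnerProductSpace
open scoped ENNReal

/-- `f` is a bounded Borel function on the line. -/
def IsBoundedBorel (f : ℝ → ℝ) : Prop :=
  Measurable f ∧ ∃ C : ℝ, ∀ x, |f x| ≤ C

theorem IsBoundedBorel.memLp {f : ℝ → ℝ} (hf : IsBoundedBorel f) (p : ℝ≥0∞)
    (μ : Measure ℝ) [IsFiniteMeasure μ] : MemLp f p μ := by
  obtain ⟨hm, C, hC⟩ := hf
  exact MemLp.of_bound hm.aestronglyMeasurable C (Filter.Eventually.of_forall hC)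

theorem IsBoundedBorel.mul {f h : ℝ → ℝ} (hf : IsBoundedBorel f) (hh : IsBoundedBorel h) :
    IsBoundedBorel (f * h) := by
  obtain ⟨hfm, C, hC⟩ := hf
  obtain ⟨hhm, D, hD⟩ := hh
  refine ⟨hfm.mul hhm, C * D, fun x => ?_⟩
  rw [Pi.mul_apply, abs_mul]
  exact mul_le_mul (hC x) (hD x) (abs_nonneg _) ((abs_nonneg _).trans (hC x))

theorem isBoundedBorel_one : IsBoundedBorel (1 : ℝ → ℝ) :=
  ⟨measurable_one, 1, fun _ => by simp⟩

theorem IsBoundedBorel.pow {f : ℝ → ℝ} (hf : IsBoundedBorel f) :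
    ∀ n : ℕ, IsBoundedBorel (f ^ n)
  | 0 => by simpa using isBoundedBorel_one
  | n + 1 => by
    rw [pow_succ]
    exact (hf.pow n).mul hf

/-- The objects of the category `𝒪`: bounded self-adjoint operators on the Hilbert space `H`. -/
structure Observable (H : Type u) [NormedAddCommGroup H] [InnerProductSpace ℂ H]
    [CompleteSpace H] where
  /-- the underlying operator -/
  op : H →L[ℂ] H
  isSelfAdjoint : IsSelfAdjoint op

namespace Observable

variable {H : Type u} [NormedAddCommGroup H] [InnerProductSpace ℂ H] [CompleteSpace H]

/-- The positive functional `g ↦ ⟨ψ, g(A) ψ⟩` on the continuous functions on the spectrum. -/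
noncomputable def functional (A : Observable H) (ψ : H) :
    CompactlySupportedContinuousMap (spectrum ℝ A.op) ℝ →ₚ[ℝ] ℝ :=
  PositiveLinearMap.mk₀
    { toFun := fun g => (inner ℂ ψ (cfcHom A.isSelfAdjoint g.toContinuousMap ψ)).re
      map_add' := fun g h => by
        have : (g + h).toContinuousMap = g.toContinuousMap + h.toContinuousMap := rfl
        simp [this, map_add]
      map_smul' := fun c g => by
        have : (c • g).toContinuousMap = c • g.toContinuousMap := rfl
        simp only [this, map_smul]
        simp [inner_smul_right_eq_smul] }
    (fun g hg => by
      have h0 : (0 : H →L[ℂ] H) ≤ cfcHom A.isSelfAdjoint g.toContinuousMap := by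
        rw [cfcHom_nonneg_iff]
        intro x
        exact hg x
      rw [ContinuousLinearMap.nonneg_iff_isPositive] at h0
      exact h0.re_inner_nonneg_right ψ)

/-- The spectral measure `μ^A_ψ = ⟨ψ, E^A(·) ψ⟩` of `A` in the vector `ψ`: the measure, carried by the
spectrum of `A`, that represents the functional `g ↦ ⟨ψ, g(A) ψ⟩` (Riesz-Markov-Kakutani). -/
noncomputable def spectralMeasure (A : Observable H) (ψ : H) : Measure ℝ :=
  (RealRMK.rieszMeasure (A.functional ψ)).map Subtype.val

instance (A : Observable H) (ψ : H) : IsFiniteMeasure (A.spectralMeasure ψ) := by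
  unfold spectralMeasure
  infer_instance

theorem spectralMeasure_compl_spectrum (A : Observable H) (ψ : H) :
    A.spectralMeasure ψ (spectrum ℝ A.op)ᶜ = 0 := by
  unfold spectralMeasure
  rw [Measure.map_apply measurable_subtype_coe (spectrum.isCompact _).measurableSet.compl]
  simp

theorem integral_spectralMeasure (A : Observable H) (ψ : H) {g : ℝ → ℝ} (hg : Continuous g) :
    ∫ x, g x ∂(A.spectralMeasure ψ) = (inner ℂ ψ (cfc g A.op ψ)).re := by
  unfold spectralMeasure
  rw [integral_map measurable_subtype_coe.aemeasurable hg.aestronglyMeasurable]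
  have := RealRMK.integral_rieszMeasure (A.functional ψ)
    ⟨⟨fun x => g x, by fun_prop⟩, HasCompactSupport.of_compactSpace _⟩
  rw [cfc_apply g A.op A.isSelfAdjoint]
  exact this


theorem ae_mem_spectrum (A : Observable H) (ψ : H) :
    ∀ᵐ x ∂(A.spectralMeasure ψ), x ∈ spectrum ℝ A.op :=
  A.spectralMeasure_compl_spectrum ψ

theorem memLp_of_continuous (A : Observable H) (ψ : H) {g : ℝ → ℝ} (hg : Continuous g)
    (p : ℝ≥0∞) : MemLp g p (A.spectralMeasure ψ) := by
  obtain ⟨C, hC⟩ := (spectrum.isCompact (𝕜 := ℝ) A.op).exists_bound_of_continuousOn hg.continuousOn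
  refine MemLp.of_bound hg.aestronglyMeasurable C ?_
  filter_upwards [A.ae_mem_spectrum ψ] with x hx using hC x hx

theorem enorm_cfc_apply (A : Observable H) (ψ : H) {g : ℝ → ℝ} (hg : Continuous g) :
    ‖cfc g A.op ψ‖ₑ = eLpNorm g 2 (A.spectralMeasure ψ) := by
  have h1 : ‖cfc g A.op ψ‖ ^ 2 = ∫ x, g x ^ 2 ∂(A.spectralMeasure ψ) := by
    rw [A.integral_spectralMeasure ψ (g := fun x => g x ^ 2) (by fun_prop), cfc_pow g 2 A.op hg.continuousOn A.isSelfAdjoint,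
      sq (cfc g A.op), mul_apply_eq_comp]
    have hs : IsSelfAdjoint (cfc g A.op) := cfc_predicate g A.op
    rw [← ContinuousLinearMap.adjoint_inner_left, hs.adjoint_eq, inner_self_eq_norm_sq_to_K]
    norm_cast
  have h2 := (A.memLp_of_continuous ψ hg 2).eLpNorm_eq_integral_rpow_norm (by norm_num) (by norm_num)
  rw [h2, ← ofReal_norm]
  congr 1
  simp only [ENNReal.toReal_ofNat, Real.rpow_ofNat, Real.norm_eq_abs, sq_abs]
  rw [← h1, ← one_div, ← Real.sqrt_eq_rpow, Real.sqrt_sq (norm_nonneg _)]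

theorem exists_continuous_approx {f : ℝ → ℝ} (hf : IsBoundedBorel f) (ν : Measure ℝ)
    [IsFiniteMeasure ν] {ε : ℝ≥0∞} (hε : ε ≠ 0) :
    ∃ g : ℝ → ℝ, Continuous g ∧ eLpNorm (f - g) 2 ν ≤ ε := by
  obtain ⟨g, hg, -⟩ := (hf.memLp 2 ν).exists_boundedContinuous_eLpNorm_sub_le (by norm_num) hε
  exact ⟨g, g.continuous, hg⟩

/-- Auxiliary: `v` is the vector `f(A) ψ`, the limit of the `g(A) ψ` with `g` continuous and `g → f` in
`L²(μ^A_ψ)`. -/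
def IsApply (A : Observable H) (f : ℝ → ℝ) (ψ v : H) : Prop :=
  ∀ g : ℝ → ℝ, Continuous g →
    ‖v - cfc g A.op ψ‖ₑ ≤ eLpNorm (f - g) 2 (A.spectralMeasure ψ)

theorem cfc_sub_apply (A : Observable H) (ψ : H) {g h : ℝ → ℝ} (hg : Continuous g)
    (hh : Continuous h) : cfc g A.op ψ - cfc h A.op ψ = cfc (g - h) A.op ψ := by
  have := cfc_sub g h A.op hg.continuousOn hh.continuousOn
  rw [show (g - h) = fun x => g x - h x from rfl, this]
  rfl

theorem exists_isApply (A : Observable H) {f : ℝ → ℝ} (hf : IsBoundedBorel f) (ψ : H) :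
    ∃ v, A.IsApply f ψ v := by
  set μ := A.spectralMeasure ψ with hμ
  have key : ∀ n : ℕ, ∃ g : ℝ → ℝ, Continuous g ∧ eLpNorm (f - g) 2 μ ≤ (1 / 2) / 2 ^ n :=
    fun n => exists_continuous_approx hf μ (by simp)
  choose g hgc hg using key
  have tri : ∀ (h k : ℝ → ℝ), Continuous h → Continuous k →
      eLpNorm (h - k) 2 μ ≤ eLpNorm (f - h) 2 μ + eLpNorm (f - k) 2 μ := by
    intro h k hh hk
    have hfm := hf.1.aestronglyMeasurable (μ := μ)
    have e : h - k = (f - k) - (f - h) := by ring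
    rw [e, add_comm]
    exact eLpNorm_sub_le (hfm.sub hk.aestronglyMeasurable) (hfm.sub hh.aestronglyMeasurable)
      (by norm_num)
  have hd : ∀ n, edist (cfc (g n) A.op ψ) (cfc (g (n + 1)) A.op ψ) ≤ 1 / 2 ^ n := by
    intro n
    rw [edist_eq_enorm_sub, A.cfc_sub_apply ψ (hgc n) (hgc _),
      A.enorm_cfc_apply ψ ((hgc n).sub (hgc _))]
    refine (tri _ _ (hgc n) (hgc _)).trans ?_
    calc _ ≤ (1 / 2 : ℝ≥0∞) / 2 ^ n + (1 / 2) / 2 ^ n := by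
            refine add_le_add (hg n) ((hg (n + 1)).trans ?_)
            exact ENNReal.div_le_div_left (pow_le_pow_right₀ (by norm_num) (Nat.le_succ n)) _
      _ = 1 / 2 ^ n := by rw [ENNReal.div_add_div_same, ENNReal.add_halves]
  obtain ⟨v, hv⟩ := cauchySeq_tendsto_of_complete (cauchySeq_of_edist_le_geometric_two 1
    ENNReal.one_ne_top hd)
  refine ⟨v, fun h hh => ?_⟩
  have lim : Filter.Tendsto (fun n => ‖v - cfc (g n) A.op ψ‖ₑ + ((1 / 2) / 2 ^ n
      + eLpNorm (f - h) 2 μ)) Filter.atTop (nhds (0 + (0 + eLpNorm (f - h) 2 μ))) := by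
    refine Filter.Tendsto.add ?_ (Filter.Tendsto.add ?_ tendsto_const_nhds)
    · have := (tendsto_const_nhds (x := v)).sub hv
      rw [sub_self] at this
      simpa using this.enorm
    · have : Filter.Tendsto (fun n : ℕ => (1 / 2 : ℝ≥0∞) * (2⁻¹) ^ n) Filter.atTop (nhds (1 / 2 * 0)) :=
        ENNReal.Tendsto.const_mul (ENNReal.tendsto_pow_atTop_nhds_zero_of_lt_one (by norm_num))
          (Or.inr (by norm_num))
      rw [mul_zero] at this
      refine this.congr fun n => ?_
      rw [div_eq_mul_inv (1 / 2 : ℝ≥0∞) (2 ^ n), ENNReal.inv_pow]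
  rw [zero_add, zero_add] at lim
  refine ge_of_tendsto' lim fun n => ?_
  calc ‖v - cfc h A.op ψ‖ₑ
      = ‖(v - cfc (g n) A.op ψ) + (cfc (g n) A.op ψ - cfc h A.op ψ)‖ₑ := by
        rw [sub_add_sub_cancel]
    _ ≤ _ := by
        refine (enorm_add_le _ _).trans ?_
        gcongr
        rw [A.cfc_sub_apply ψ (hgc n) hh, A.enorm_cfc_apply ψ ((hgc n).sub hh)]
        refine (tri _ _ (hgc n) hh).trans ?_
        gcongr
        exact hg n

theorem le_of_approx (A : Observable H) {f : ℝ → ℝ} (hf : IsBoundedBorel f) (a b c : H)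
    (r D K : ℝ≥0∞) (hK : K ≠ ∞)
    (h : ∀ g : ℝ → ℝ, Continuous g → r ≤ D + K * (eLpNorm (f - g) 2 (A.spectralMeasure a) +
      eLpNorm (f - g) 2 (A.spectralMeasure b) + eLpNorm (f - g) 2 (A.spectralMeasure c))) :
    r ≤ D := by
  set ν := A.spectralMeasure a + A.spectralMeasure b + A.spectralMeasure c with hν
  have hle : ∀ ε : ℝ≥0∞, ε ≠ 0 → r ≤ D + K * (ε + ε + ε) := by
    intro ε hε
    obtain ⟨g, hg, hgε⟩ := exists_continuous_approx hf ν hε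
    refine (h g hg).trans ?_
    gcongr
    · refine (eLpNorm_mono_measure _ ?_).trans hgε
      rw [hν, add_assoc]
      exact Measure.le_add_right le_rfl
    · refine (eLpNorm_mono_measure _ ?_).trans hgε
      rw [hν, add_assoc]
      exact Measure.le_add_left (Measure.le_add_right le_rfl)
    · refine (eLpNorm_mono_measure _ ?_).trans hgε
      exact Measure.le_add_left le_rfl
  have lim : Filter.Tendsto (fun n : ℕ => D + K * (((2 : ℝ≥0∞)⁻¹) ^ n + (2⁻¹) ^ n + (2⁻¹) ^ n))
      Filter.atTop (nhds (D + K * (0 + 0 + 0))) := by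
    have := ENNReal.tendsto_pow_atTop_nhds_zero_of_lt_one (r := (2 : ℝ≥0∞)⁻¹) (by norm_num)
    exact tendsto_const_nhds.add
      (ENNReal.Tendsto.const_mul ((this.add this).add this) (Or.inr hK))
  have h0 : r ≤ D + K * (0 + 0 + 0) :=
    ge_of_tendsto' lim fun n => hle _ (by simp)
  simpa using h0

theorem eq_zero_of_approx {E : Type*} [NormedAddCommGroup E] (A : Observable H) {f : ℝ → ℝ}
    (hf : IsBoundedBorel f) (a b c : H) (w : E) (K : ℝ≥0∞) (hK : K ≠ ∞)
    (h : ∀ g : ℝ → ℝ, Continuous g → ‖w‖ₑ ≤ K * (eLpNorm (f - g) 2 (A.spectralMeasure a) +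
      eLpNorm (f - g) 2 (A.spectralMeasure b) + eLpNorm (f - g) 2 (A.spectralMeasure c))) :
    w = 0 := by
  have h0 := A.le_of_approx hf a b c ‖w‖ₑ 0 K hK fun g hg => by
    rw [zero_add]
    exact h g hg
  simpa using h0

theorem IsApply.unique {A : Observable H} {f : ℝ → ℝ} (hf : IsBoundedBorel f) {ψ v w : H}
    (hv : A.IsApply f ψ v) (hw : A.IsApply f ψ w) : v = w := by
  rw [← sub_eq_zero]
  refine A.eq_zero_of_approx hf ψ ψ ψ _ 1 ENNReal.one_ne_top fun g hg => ?_
  rw [← sub_sub_sub_cancel_right v w (cfc g A.op ψ), one_mul]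
  exact (enorm_sub_le).trans ((add_le_add (hv g hg) (hw g hg)).trans le_self_add)

theorem eLpNorm_const_one (A : Observable H) (ψ : H) :
    eLpNorm (fun _ => (1 : ℝ)) 2 (A.spectralMeasure ψ) = ‖ψ‖ₑ := by
  rw [← A.enorm_cfc_apply ψ continuous_const, cfc_const_one ℝ A.op A.isSelfAdjoint]
  rfl

theorem IsApply.enorm_le {A : Observable H} {f : ℝ → ℝ} {ψ v : H}
    (hv : A.IsApply f ψ v) : ‖v‖ₑ ≤ eLpNorm f 2 (A.spectralMeasure ψ) := by
  have := hv (fun _ => 0) continuous_const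
  rw [cfc_const_zero] at this
  simpa [show f - (fun _ => (0 : ℝ)) = f from sub_zero f] using this

theorem exists_borelOp (A : Observable H) {f : ℝ → ℝ} (hf : IsBoundedBorel f) :
    ∃ T : H →L[ℂ] H, ∀ ψ, A.IsApply f ψ (T ψ) := by
  choose v hv using fun ψ => A.exists_isApply hf ψ
  obtain ⟨C, hC⟩ := hf.2
  let L : H →ₗ[ℂ] H :=
    { toFun := v
      map_add' := fun x y => by
        rw [← sub_eq_zero]
        refine A.eq_zero_of_approx hf (x + y) x y _ 1 ENNReal.one_ne_top fun g hg => ?_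
        rw [one_mul]
        have e : v (x + y) - (v x + v y) = (v (x + y) - cfc g A.op (x + y)) -
            (v x - cfc g A.op x) - (v y - cfc g A.op y) := by
          rw [map_add]; abel
        rw [e]
        exact enorm_sub_le.trans (add_le_add (enorm_sub_le.trans
          (add_le_add (hv _ g hg) (hv _ g hg))) (hv _ g hg))
      map_smul' := fun c x => by
        rw [← sub_eq_zero]
        refine A.eq_zero_of_approx hf (c • x) x x _ (1 + ‖c‖ₑ) (by simp) fun g hg => ?_
        have e : v (c • x) - (RingHom.id ℂ) c • v x = (v (c • x) - cfc g A.op (c • x)) -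
            c • (v x - cfc g A.op x) := by
          rw [map_smul, smul_sub]; simp
        rw [e]
        refine enorm_sub_le.trans ?_
        rw [enorm_smul, add_mul, one_mul]
        refine add_le_add ((hv _ g hg).trans ?_) (mul_le_mul_right ((hv _ g hg).trans ?_) _)
        · rw [add_assoc]; exact le_self_add
        · exact le_add_self }
  refine ⟨L.mkContinuous |C| fun ψ => ?_, fun ψ => hv ψ⟩
  have h1 : eLpNorm f 2 (A.spectralMeasure ψ) ≤ ENNReal.ofReal |C| * ‖ψ‖ₑ := by
    rw [← A.eLpNorm_const_one ψ]
    refine eLpNorm_le_mul_eLpNorm_of_ae_le_mul (Filter.Eventually.of_forall fun x => ?_) 2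
    simpa using (hC x).trans (le_abs_self C)
  have h2 := (hv ψ).enorm_le.trans h1
  rw [← ofReal_norm, ← ofReal_norm, ← ENNReal.ofReal_mul (abs_nonneg C)] at h2
  exact (ENNReal.ofReal_le_ofReal_iff (by positivity)).1 h2

theorem IsApply.inner_eq {A : Observable H} {f : ℝ → ℝ} (hf : IsBoundedBorel f) {ψ v : H}
    (hv : A.IsApply f ψ v) : inner ℂ ψ v = ((∫ x, f x ∂(A.spectralMeasure ψ) : ℝ) : ℂ) := by
  rw [← sub_eq_zero]
  set μ := A.spectralMeasure ψ with hμ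
  have hb : ∀ g : ℝ → ℝ, Continuous g →
      ‖inner ℂ ψ v - ((∫ x, f x ∂μ : ℝ) : ℂ)‖ₑ ≤ ‖ψ‖ₑ * eLpNorm (f - g) 2 μ +
        ‖ψ‖ₑ * eLpNorm (f - g) 2 μ := by
    intro g hg
    have hgi : ∫ x, g x ∂μ = (inner ℂ ψ (cfc g A.op ψ)).re := A.integral_spectralMeasure ψ hg
    have hs : IsSelfAdjoint (cfc g A.op) := cfc_predicate g A.op
    have hgi' : inner ℂ ψ (cfc g A.op ψ) = ((∫ x, g x ∂μ : ℝ) : ℂ) := by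
      rw [hgi]
      exact (hs.isSymmetric.coe_re_inner_self_apply ψ).symm
    have e : inner ℂ ψ v - ((∫ x, f x ∂μ : ℝ) : ℂ) = inner ℂ ψ (v - cfc g A.op ψ) -
        ((∫ x, (f - g) x ∂μ : ℝ) : ℂ) := by
      have : ∫ x, (f - g) x ∂μ = ∫ x, f x ∂μ - ∫ x, g x ∂μ :=
        integral_sub ((hf.memLp 1 μ).integrable le_rfl)
          ((A.memLp_of_continuous ψ hg 1).integrable le_rfl)
      rw [this, inner_sub_right, hgi']
      push_cast
      ring
    rw [e]
    refine enorm_sub_le.trans (add_le_add ?_ ?_)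
    · refine le_trans ?_ (mul_le_mul_right (hv g hg) _)
      rw [← ofReal_norm, ← ofReal_norm, ← ofReal_norm, ← ENNReal.ofReal_mul (norm_nonneg _)]
      exact ENNReal.ofReal_le_ofReal (norm_inner_le_norm _ _)
    · have e1 : ‖((∫ x, (f - g) x ∂μ : ℝ) : ℂ)‖ₑ = ‖∫ x, (f - g) x ∂μ‖ₑ := by
        rw [← ofReal_norm, ← ofReal_norm, Complex.norm_real]
      rw [e1]
      refine (enorm_integral_le_lintegral_enorm _).trans ?_
      have hm : AEStronglyMeasurable (f - g) μ :=
        hf.1.aestronglyMeasurable.sub hg.aestronglyMeasurable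
      rw [← eLpNorm_one_eq_lintegral_enorm]
      refine (eLpNorm_le_eLpNorm_mul_rpow_measure_univ (q := 2) (by norm_num) hm).trans ?_
      rw [mul_comm]
      gcongr
      rw [← A.eLpNorm_const_one ψ, eLpNorm_const' _ (by norm_num) (by norm_num), ← hμ]
      norm_num
  refine A.eq_zero_of_approx hf ψ ψ ψ _ ‖ψ‖ₑ (by simp) fun g hg => (hb g hg).trans ?_
  rw [mul_add, mul_add]
  exact le_self_add

theorem eLpNorm_mul_le {μ : Measure ℝ} {f h : ℝ → ℝ} {C : ℝ} (hC : ∀ᵐ x ∂μ, |f x| ≤ C) :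
    eLpNorm (f * h) 2 μ ≤ ENNReal.ofReal C * eLpNorm h 2 μ := by
  refine eLpNorm_le_mul_eLpNorm_of_ae_le_mul ?_ 2
  filter_upwards [hC] with x hx
  simpa using mul_le_mul_of_nonneg_right hx (abs_nonneg (h x))

theorem isApply_mul (A : Observable H) {f h : ℝ → ℝ} (hf : IsBoundedBorel f)
    (hh : IsBoundedBorel h) {S T U : H →L[ℂ] H} (hS : ∀ ψ, A.IsApply f ψ (S ψ))
    (hT : ∀ ψ, A.IsApply h ψ (T ψ)) (hU : ∀ ψ, A.IsApply (f * h) ψ (U ψ)) : S * T = U := by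
  ext ψ
  change S (T ψ) = U ψ
  rw [← sub_eq_zero]
  obtain ⟨C, hC⟩ := hf.2
  set N := fun (χ : H) (u : ℝ → ℝ) => eLpNorm u 2 (A.spectralMeasure χ) with hN
  refine A.eq_zero_of_approx hh ψ ψ ψ _ (‖S‖ₑ + ENNReal.ofReal C) (by simp) fun g hg => ?_
  obtain ⟨G, hG⟩ := (spectrum.isCompact (𝕜 := ℝ) A.op).exists_bound_of_continuousOn
    hg.continuousOn
  have main : ‖S (T ψ) - U ψ‖ₑ ≤ (‖S‖ₑ + ENNReal.ofReal C) * N ψ (h - g) := by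
    refine A.le_of_approx hf (cfc g A.op ψ) ψ ψ _ _ (1 + ENNReal.ofReal G) (by simp)
      fun k hk => ?_
    have e : S (T ψ) - U ψ = S (T ψ - cfc g A.op ψ) +
        ((S (cfc g A.op ψ) - cfc k A.op (cfc g A.op ψ)) -
          (U ψ - cfc (fun x => k x * g x) A.op ψ)) := by
      rw [cfc_mul k g A.op hk.continuousOn hg.continuousOn, map_sub]
      change _ = S (T ψ) - S (cfc g A.op ψ) +
        ((S (cfc g A.op ψ) - cfc k A.op (cfc g A.op ψ)) - (U ψ - cfc k A.op (cfc g A.op ψ)))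
      abel
    have h1 : ‖S (T ψ - cfc g A.op ψ)‖ₑ ≤ ‖S‖ₑ * N ψ (h - g) :=
      (S.le_opENorm _).trans (mul_le_mul_right (hT ψ g hg) _)
    have h2 := hS (cfc g A.op ψ) k hk
    have h3 : ‖U ψ - cfc (fun x => k x * g x) A.op ψ‖ₑ ≤
        ENNReal.ofReal C * N ψ (h - g) + ENNReal.ofReal G * N ψ (f - k) := by
      refine (hU ψ _ (hk.mul hg)).trans ?_
      have e2 : f * h - k * g = f * (h - g) + g * (f - k) := by
        ext x
        simp only [Pi.sub_apply, Pi.mul_apply, Pi.add_apply]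
        ring
      have hfm := hf.1.aestronglyMeasurable (μ := A.spectralMeasure ψ)
      have hhm := hh.1.aestronglyMeasurable (μ := A.spectralMeasure ψ)
      have hgm := hg.aestronglyMeasurable (μ := A.spectralMeasure ψ)
      have hkm := hk.aestronglyMeasurable (μ := A.spectralMeasure ψ)
      rw [e2]
      refine (eLpNorm_add_le (hfm.mul (hhm.sub hgm)) (hgm.mul (hfm.sub hkm))
        (by norm_num)).trans (add_le_add ?_ ?_)
      · exact eLpNorm_mul_le (Filter.Eventually.of_forall hC)
      · refine eLpNorm_mul_le ?_
        filter_upwards [A.ae_mem_spectrum ψ] with x hx using hG x hx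
    rw [e]
    calc _ ≤ ‖S‖ₑ * N ψ (h - g) + (N (cfc g A.op ψ) (f - k) +
          (ENNReal.ofReal C * N ψ (h - g) + ENNReal.ofReal G * N ψ (f - k))) :=
        (enorm_add_le _ _).trans (add_le_add h1 (enorm_sub_le.trans (add_le_add h2 h3)))
      _ = (‖S‖ₑ + ENNReal.ofReal C) * N ψ (h - g) + (N (cfc g A.op ψ) (f - k) +
          ENNReal.ofReal G * N ψ (f - k)) := by ring
      _ ≤ _ := by
        gcongr
        rw [add_mul, one_mul]
        refine add_le_add ?_ ?_
        · rw [add_assoc]; exact le_self_add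
        · gcongr
          exact le_add_self
  refine main.trans ?_
  gcongr
  exact le_add_self

theorem existsUnique_borelFun (A : Observable H) {f : ℝ → ℝ} (hf : IsBoundedBorel f) :
    ∃! T : H →L[ℂ] H, ∀ ψ, inner ℂ ψ (T ψ) = ((∫ x, f x ∂(A.spectralMeasure ψ) : ℝ) : ℂ) := by
  obtain ⟨T, hT⟩ := A.exists_borelOp hf
  refine ⟨T, fun ψ => (hT ψ).inner_eq hf, fun S hS => ?_⟩
  apply ContinuousLinearMap.coe_injective
  rw [← ext_inner_map]
  intro ψ
  have := (hS ψ).trans ((hT ψ).inner_eq hf).symm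
  change inner ℂ (S ψ) ψ = inner ℂ (T ψ) ψ
  rw [← inner_conj_symm, this, inner_conj_symm]

/-- The operator `f(A) = ∫ f(λ) dE^A_λ` for a bounded Borel function `f`: the unique operator with
`⟨ψ, f(A) ψ⟩ = ∫ f(λ) d⟨ψ, E^A_λ ψ⟩` for all `ψ` (by polarization this determines the matrix
elements `⟨ψ, f(A) φ⟩`). Only the values of `f` on the spectrum of `A` matter. -/
noncomputable def borelFun (A : Observable H) (f : ℝ → ℝ) (hf : IsBoundedBorel f) : H →L[ℂ] H :=
  (A.existsUnique_borelFun hf).choose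

theorem inner_borelFun (A : Observable H) {f : ℝ → ℝ} (hf : IsBoundedBorel f) (ψ : H) :
    inner ℂ ψ (A.borelFun f hf ψ) = ((∫ x, f x ∂(A.spectralMeasure ψ) : ℝ) : ℂ) :=
  (A.existsUnique_borelFun hf).choose_spec.1 ψ

theorem isApply_borelFun (A : Observable H) {f : ℝ → ℝ} (hf : IsBoundedBorel f) (ψ : H) :
    A.IsApply f ψ (A.borelFun f hf ψ) := by
  obtain ⟨T, hT⟩ := A.exists_borelOp hf
  rw [show A.borelFun f hf = T from (A.existsUnique_borelFun hf).unique (A.inner_borelFun hf)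
    fun ψ => (hT ψ).inner_eq hf]
  exact hT ψ

theorem borelFun_mul (A : Observable H) {f h : ℝ → ℝ} (hf : IsBoundedBorel f)
    (hh : IsBoundedBorel h) :
    A.borelFun f hf * A.borelFun h hh = A.borelFun (f * h) (hf.mul hh) :=
  A.isApply_mul hf hh (A.isApply_borelFun hf) (A.isApply_borelFun hh)
    (A.isApply_borelFun (hf.mul hh))

theorem isSelfAdjoint_borelFun (A : Observable H) {f : ℝ → ℝ} (hf : IsBoundedBorel f) :
    IsSelfAdjoint (A.borelFun f hf) := by
  rw [ContinuousLinearMap.isSelfAdjoint_iff_isSymmetric, LinearMap.isSymmetric_iff_inner_map_self_real]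
  intro ψ
  have h := A.inner_borelFun hf ψ
  change (starRingEnd ℂ) (inner ℂ (A.borelFun f hf ψ) ψ) = inner ℂ (A.borelFun f hf ψ) ψ
  rw [inner_conj_symm, ← inner_conj_symm (A.borelFun f hf ψ) ψ, h, Complex.conj_ofReal]

theorem inner_borelFun_pow (A : Observable H) {f : ℝ → ℝ} (hf : IsBoundedBorel f) (n : ℕ)
    (ψ : H) : inner ℂ ψ ((A.borelFun f hf ^ n) ψ) =
      ((∫ x, f x ^ n ∂(A.spectralMeasure ψ) : ℝ) : ℂ) := by
  have key : A.borelFun f hf ^ n = A.borelFun (f ^ n) (hf.pow n) := by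
    induction n with
    | zero =>
      refine (A.existsUnique_borelFun (hf.pow 0)).unique (fun ψ => ?_) (A.inner_borelFun _)
      have h := A.integral_spectralMeasure ψ (g := fun _ => 1) continuous_const
      rw [cfc_const_one ℝ A.op A.isSelfAdjoint] at h
      have e : ∀ x, (f ^ 0) x = 1 := fun x => by simp
      simp only [e]
      rw [h]
      simp [inner_self_eq_norm_sq_to_K, ← Complex.ofReal_pow]
    | succ n ih =>
      rw [pow_succ, ih, borelFun_mul]
      congr 1
  rw [key, inner_borelFun]
  rfl

theorem ext_of_moments {μ ν : Measure ℝ} [IsFiniteMeasure μ] [IsFiniteMeasure ν] {R : ℝ}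
    (hμ : ∀ᵐ x ∂μ, x ∈ Set.Icc (-R) R) (hν : ∀ᵐ x ∂ν, x ∈ Set.Icc (-R) R)
    (h : ∀ n : ℕ, ∫ x, x ^ n ∂μ = ∫ x, x ^ n ∂ν) : μ = ν := by
  have cint : ∀ (ρ : Measure ℝ) [IsFiniteMeasure ρ], (∀ᵐ x ∂ρ, x ∈ Set.Icc (-R) R) →
      ∀ g : ℝ → ℝ, Continuous g → Integrable g ρ := by
    intro ρ _ hρ g hg
    obtain ⟨C, hC⟩ := (isCompact_Icc (a := -R) (b := R)).exists_bound_of_continuousOn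
      hg.continuousOn
    refine Integrable.of_bound hg.aestronglyMeasurable C ?_
    filter_upwards [hρ] with x hx using hC x hx
  have hp : ∀ p : Polynomial ℝ, ∫ x, p.eval x ∂μ = ∫ x, p.eval x ∂ν := by
    intro p
    simp only [Polynomial.eval_eq_sum_range]
    rw [integral_finsetSum _ fun n _ => cint μ hμ _ (by fun_prop),
      integral_finsetSum _ fun n _ => cint ν hν _ (by fun_prop)]
    simp only [integral_const_mul, h]
  refine ext_of_forall_integral_eq_of_IsFiniteMeasure fun u => ?_
  rw [← sub_eq_zero, ← abs_eq_zero]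
  refine le_antisymm (le_of_forall_pos_le_add fun ε hε => ?_) (abs_nonneg _)
  set m := μ.real Set.univ + ν.real Set.univ + 1 with hm
  have hmpos : 0 < m := by positivity
  obtain ⟨p, hpu⟩ := exists_polynomial_near_of_continuousOn (-R) R u u.continuous.continuousOn
    (ε / m) (by positivity)
  have bd : ∀ (ρ : Measure ℝ) [IsFiniteMeasure ρ], (∀ᵐ x ∂ρ, x ∈ Set.Icc (-R) R) →
      |∫ x, u x ∂ρ - ∫ x, p.eval x ∂ρ| ≤ ε / m * ρ.real Set.univ := by
    intro ρ _ hρ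
    rw [← integral_sub (cint ρ hρ _ u.continuous) (cint ρ hρ _ p.continuous)]
    rw [← Real.norm_eq_abs]
    refine norm_integral_le_of_norm_le_const ?_
    filter_upwards [hρ] with x hx
    rw [Real.norm_eq_abs, abs_sub_comm]
    exact (hpu x hx).le
  have h1 := bd μ hμ
  have h2 := bd ν hν
  rw [hp p] at h1
  have h3 : |∫ x, u x ∂μ - ∫ x, u x ∂ν| ≤ ε / m * μ.real Set.univ + ε / m * ν.real Set.univ := by
    rw [abs_le] at h1 h2 ⊢
    constructor <;> linarith [h1.1, h1.2, h2.1, h2.2]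
  have h4 : ε / m * μ.real Set.univ + ε / m * ν.real Set.univ ≤ ε := by
    have : ε / m * m = ε := by field_simp
    have h5 : 0 < ε / m := by positivity
    rw [hm, mul_add, mul_add] at this
    linarith
  rw [zero_add]
  exact h3.trans h4

theorem spectralMeasure_of_eq_borelFun (A B : Observable H) {f : ℝ → ℝ} (hf : IsBoundedBorel f)
    (hB : B.op = A.borelFun f hf) (ψ : H) :
    B.spectralMeasure ψ = (A.spectralMeasure ψ).map f := by
  obtain ⟨C, hC⟩ := hf.2
  obtain ⟨D, hD⟩ := (spectrum.isCompact (𝕜 := ℝ) B.op).exists_bound_of_continuousOn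
    continuous_id.continuousOn
  have hicc : ∀ {x r : ℝ}, |x| ≤ r → r ≤ max C D → x ∈ Set.Icc (-(max C D)) (max C D) :=
    fun h1 h2 => abs_le.1 (h1.trans h2)
  refine ext_of_moments (R := max C D) ?_ ?_ fun n => ?_
  · filter_upwards [B.ae_mem_spectrum ψ] with x hx using hicc (hD x hx) (le_max_right _ _)
  · refine (ae_map_iff hf.1.aemeasurable measurableSet_Icc).2 ?_
    exact Filter.Eventually.of_forall fun x => hicc (hC x) (le_max_left _ _)
  · rw [integral_map hf.1.aemeasurable (by fun_prop)]
    have h1 := B.integral_spectralMeasure ψ (g := fun x => x ^ n) (by fun_prop)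
    rw [cfc_pow_id B.op n B.isSelfAdjoint, hB, A.inner_borelFun_pow hf n ψ, Complex.ofReal_re] at h1
    exact h1

theorem eq_borelFun_id (A : Observable H) : ∃ f, ∃ hf : IsBoundedBorel f, A.op = A.borelFun f hf := by
  have hm : MeasurableSet (spectrum ℝ A.op) := (spectrum.isCompact A.op).measurableSet
  obtain ⟨D, hD⟩ := (spectrum.isCompact (𝕜 := ℝ) A.op).exists_bound_of_continuousOn
    continuous_id.continuousOn
  have hf : IsBoundedBorel ((spectrum ℝ A.op).indicator id) := by
    refine ⟨measurable_id.indicator hm, |D|, fun x => ?_⟩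
    by_cases hx : x ∈ spectrum ℝ A.op
    · rw [Set.indicator_of_mem hx]
      exact (hD x hx).trans (le_abs_self D)
    · rw [Set.indicator_of_notMem hx]
      simp
  refine ⟨_, hf, (A.existsUnique_borelFun hf).unique (fun ψ => ?_) (A.inner_borelFun hf)⟩
  have h1 := A.integral_spectralMeasure ψ continuous_id
  rw [cfc_id ℝ A.op A.isSelfAdjoint] at h1
  have h2 : ∫ x, (spectrum ℝ A.op).indicator id x ∂(A.spectralMeasure ψ) =
      ∫ x, id x ∂(A.spectralMeasure ψ) := by
    refine integral_congr_ae ?_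
    filter_upwards [A.ae_mem_spectrum ψ] with x hx using Set.indicator_of_mem hx _
  rw [h2, h1]
  exact (A.isSelfAdjoint.isSymmetric.coe_re_inner_self_apply ψ).symm

/-- The category `𝒪`. There is a morphism `f_𝒪 : B ⟶ A` if `B = f(A)` for some Borel function `f`, and
there is at most one, because `f` counts only up to the equivalence `f(A) = g(A)`. So `𝒪` is the
preorder below, and Mathlib regards every preorder as a category. -/
instance : Preorder (Observable H) where
  le B A := ∃ f, ∃ hf : IsBoundedBorel f, B.op = A.borelFun f hf
  le_refl A := A.eq_borelFun_id
  le_trans C B A := by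
    rintro ⟨g, hg, hC⟩ ⟨f, hf, hB⟩
    have hgf : IsBoundedBorel (g ∘ f) :=
      ⟨hg.1.comp hf.1, hg.2.choose, fun x => hg.2.choose_spec (f x)⟩
    refine ⟨g ∘ f, hgf, (A.existsUnique_borelFun hgf).unique (fun ψ => ?_) (A.inner_borelFun hgf)⟩
    rw [hC, B.inner_borelFun hg, A.spectralMeasure_of_eq_borelFun B hf hB,
      integral_map hf.1.aemeasurable hg.1.aestronglyMeasurable]
    rfl

end Observable

variable {H : Type u} [NormedAddCommGroup H] [InnerProductSpace ℂ H] [CompleteSpace H]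

variable (H) in
/-- The projection operators on `H`, with the order `P ≤ Q` of operators. -/
abbrev Projector : Type u := {P : H →L[ℂ] H // IsStarProjection P}

theorem isClosed_iInf_range (S : Set (Projector H)) :
    IsClosed ((⨅ P ∈ S, (P.1.range : Submodule ℂ H) : Submodule ℂ H) : Set H) := by
  simp only [Submodule.coe_iInf]
  refine isClosed_iInter fun P => isClosed_iInter fun _ => ?_
  exact ContinuousLinearMap.IsIdempotentElem.isClosed_range P.2.1

/-- The infimum in the lattice of projectors: the projector onto the intersection of the ranges. -/
noncomputable instance : InfSet (Projector H) where
  sInf S :=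
    haveI : CompleteSpace (⨅ P ∈ S, (P.1.range : Submodule ℂ H) : Submodule ℂ H) :=
      (isClosed_iInf_range S).completeSpace_coe
    ⟨(⨅ P ∈ S, (P.1.range : Submodule ℂ H)).starProjection, isStarProjection_starProjection⟩

theorem Projector.le_iff_range_le (P Q : Projector H) : P ≤ Q ↔ P.1.range ≤ Q.1.range := by
  obtain ⟨_, hP⟩ := isStarProjection_iff_eq_starProjection_range.1 P.2
  obtain ⟨_, hQ⟩ := isStarProjection_iff_eq_starProjection_range.1 Q.2
  rw [← Subtype.coe_le_coe]
  conv_lhs => rw [hP, hQ]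
  exact Submodule.starProjection_le_starProjection_iff

theorem Projector.isGLB_sInf (S : Set (Projector H)) : IsGLB S (sInf S) := by
  have hr : (sInf S : Projector H).1.range = ⨅ P ∈ S, (P.1.range : Submodule ℂ H) := by
    have : CompleteSpace (⨅ P ∈ S, (P.1.range : Submodule ℂ H) : Submodule ℂ H) :=
      (isClosed_iInf_range S).completeSpace_coe
    exact Submodule.range_starProjection _
  constructor
  · intro P hP
    rw [Projector.le_iff_range_le, hr]
    exact iInf₂_le P hP
  · intro Q hQ
    rw [Projector.le_iff_range_le, hr]
    exact le_iInf₂ fun P hP => (Projector.le_iff_range_le _ _).1 (hQ hP)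

namespace Observable

/-- The Borel subsets `Δ` of the spectrum of `A`; each stands for the proposition `A ∈ Δ`. -/
abbrev BorelSubset (A : Observable H) : Type :=
  {Δ : Set ℝ // MeasurableSet Δ ∧ Δ ⊆ spectrum ℝ A.op}

theorem isBoundedBorel_indicator {Δ : Set ℝ} (hΔ : MeasurableSet Δ) :
    IsBoundedBorel (Δ.indicator 1) := by
  refine ⟨measurable_one.indicator hΔ, 1, fun x => ?_⟩
  by_cases hx : x ∈ Δ <;> simp [hx]

/-- The spectral projector `E[A ∈ Δ] = ∫_Δ dE^A_λ`. -/
noncomputable def proj (A : Observable H) (Δ : A.BorelSubset) : Projector H :=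
  ⟨A.borelFun (Δ.1.indicator 1) (isBoundedBorel_indicator Δ.2.1), by
    refine ⟨?_, A.isSelfAdjoint_borelFun _⟩
    rw [IsIdempotentElem, borelFun_mul]
    congr 1
    ext x
    by_cases hx : x ∈ Δ.1 <;> simp [hx]⟩

/-- The spectral algebra `W_A`: all projectors `E[A ∈ Δ]`. -/
def spectralAlgebra (A : Observable H) : Set (Projector H) := Set.range A.proj

/-- `E[A ∈ Δ]` as an element of `W_A`. -/
noncomputable def specProj (A : Observable H) (Δ : A.BorelSubset) : A.spectralAlgebra :=
  ⟨A.proj Δ, Δ, rfl⟩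

/-- The empty set as a Borel subset of the spectrum: the null proposition. -/
def emptySubset (A : Observable H) : A.BorelSubset :=
  ⟨∅, MeasurableSet.empty, Set.empty_subset _⟩

/-- The whole spectrum as a Borel subset of itself: the unit proposition. -/
def fullSubset (A : Observable H) : A.BorelSubset :=
  ⟨spectrum ℝ A.op, (spectrum.isCompact A.op).measurableSet, subset_rfl⟩

end Observable

open Observable

/-- Coarse-graining of a projector `P` along a morphism into an algebra `W_B`:
`inf {Q ∈ W_B | P ≤ Q}`, the infimum being taken in the lattice of all projectors. -/
noncomputable def coarseGrain {A B : Observable H} (_f : B ⟶ A) (P : Projector H) : Projector H :=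
  sInf {Q | Q ∈ B.spectralAlgebra ∧ P ≤ Q}

/-- The projector `E[B ∈ f(Δ)]` for a morphism `f_𝒪 : B ⟶ A`, i.e. `B = f(A)`, by definition
`inf {E[B ∈ K] | K Borel, E[A ∈ Δ] ≤ E[B ∈ K]}`. This makes sense whether or not `f(Δ)` is Borel, and
it depends on `f` through its equivalence class only. -/
noncomputable def imageProj {A B : Observable H} (f : B ⟶ A) (Δ : A.BorelSubset) : Projector H :=
  coarseGrain f (A.proj Δ)

/-- A generalized valuation on propositions: to each proposition `A ∈ Δ` a sieve on `A` in `𝒪`. The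
value at `h(A) ∈ h(Δ)` is the value at `h(A) ∈ J` for any Borel set `J` such that
`E[h(A) ∈ J] = E[h(A) ∈ h(Δ)]`; that there is such a `J`, and that the value does not depend on it, is
part of functional composition. -/
structure IsGeneralizedValuation (ν : ∀ A : Observable H, A.BorelSubset → Sieve A) : Prop where
  functional_composition : ∀ {A B : Observable H} (h : B ⟶ A) (Δ : A.BorelSubset),
    (∃ J : B.BorelSubset, B.proj J = imageProj h Δ) ∧
      ∀ J : B.BorelSubset, B.proj J = imageProj h Δ → ν B J = (ν A Δ).pullback h
  null : ∀ A : Observable H, ν A A.emptySubset = ⊥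
  monotone : ∀ (A : Observable H) (Δ₁ Δ₂ : A.BorelSubset), Δ₁.1 ⊆ Δ₂.1 → ν A Δ₁ ≤ ν A Δ₂
  exclusive : ∀ (A : Observable H) (Δ₁ Δ₂ : A.BorelSubset), Δ₁.1 ∩ Δ₂.1 = ∅ →
    ν A Δ₁ = ⊤ → ν A Δ₂ < ⊤

/-- The unit proposition condition `ν(A ∈ σ(A)) = true_A`. -/
def UnitCondition (ν : ∀ A : Observable H, A.BorelSubset → Sieve A) : Prop :=
  ∀ A : Observable H, ν A A.fullSubset = ⊤

/-- A generalized valuation in contextual form: maps `ν_A : W_A → Ω(A)`, where `Ω(A)` is the set of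
sieves on `A`. Functional composition includes that the coarse-graining maps `W_A` into `W_{h(A)}`. -/
structure IsContextualValuation (ν : ∀ A : Observable H, A.spectralAlgebra → Sieve A) : Prop where
  functional_composition : ∀ {A B : Observable H} (h : B ⟶ A) (P : A.spectralAlgebra),
    ∃ hP : coarseGrain h P.1 ∈ B.spectralAlgebra,
      ν B ⟨coarseGrain h P.1, hP⟩ = (ν A P).pullback h
  null : ∀ (A : Observable H) (P : A.spectralAlgebra), P.1.1 = 0 → ν A P = ⊥
  monotone : ∀ (A : Observable H) (P Q : A.spectralAlgebra), P.1 ≤ Q.1 → ν A P ≤ ν A Q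
  exclusive : ∀ (A : Observable H) (P Q : A.spectralAlgebra), P.1.1 * Q.1.1 = 0 →
    ν A P = ⊤ → ν A Q < ⊤

/-- The unit proposition condition `ν_A(1) = true_A`. -/
def ContextualUnitCondition (ν : ∀ A : Observable H, A.spectralAlgebra → Sieve A) : Prop :=
  ∀ (A : Observable H) (P : A.spectralAlgebra), P.1.1 = 1 → ν A P = ⊤

/-- The operator `T` has the trace `c`: `∑ ⟨bᵢ, T bᵢ⟩ = c` in every orthonormal (Hilbert) basis. -/
def HasTrace (T : H →L[ℂ] H) (c : ℂ) : Prop :=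
  ∀ (ι : Type u) (b : HilbertBasis ι ℂ H), HasSum (fun i => inner ℂ (b i) (T (b i))) c

variable (H) in
/-- Density matrices: positive operators of trace one. -/
structure DensityMatrix where
  /-- the underlying operator -/
  op : H →L[ℂ] H
  isPositive : op.IsPositive
  trace_one : HasTrace op 1

/-- `ν^ρ(A ∈ Δ) = {f_𝒪 : B ⟶ A | tr(ρ E[B ∈ f(Δ)]) = 1}`, as a collection of morphisms. -/
def densityArrows (ρ : DensityMatrix H) (A : Observable H) (Δ : A.BorelSubset) : Presieve A :=
  fun _ f => HasTrace (ρ.op * (imageProj f Δ).1) 1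

/-- `ν^ψ(A ∈ Δ) = {f_𝒪 : B ⟶ A | E[B ∈ f(Δ)] ψ = ψ}`, as a collection of morphisms. -/
def vectorArrows (ψ : H) (A : Observable H) (Δ : A.BorelSubset) : Presieve A :=
  fun _ f => (imageProj f Δ).1 ψ = ψ

end GenVal

open CategoryTheory GenVal

namespace GenVal

open MeasureTheory CategoryTheory InnerProductSpace
open scoped ENNReal

variable {H : Type u} [NormedAddCommGroup H] [InnerProductSpace ℂ H] [CompleteSpace H]

/-! Both valuations come from one construction. Let `F` be the set of projectors that a state makes
certain: those with `tr(ρP) = 1`, or with `Pψ = ψ`. The sieve attached to a projector consists of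
the morphisms along which its coarse-graining lands in `F`. All that is needed of `F` is
`IsCertaintySet`: it is closed upwards, contains `1`, and has no two members with product zero (so
`0` is not in it).

The conditions are then order theory of coarse-graining, which is a greatest lower bound. A morphism
`C ⟶ B` gives `W_C ⊆ W_B`, since `E[f(B) ∈ K] = E[B ∈ f⁻¹(K)]`. Hence coarse-graining can only grow
under further composition (the sieve property), and doing it in two stages equals doing it at once
(functional composition, `coarseGrain_coarseGrain`).

The analytic point is that the infimum, taken among all projectors, lies in `W_B`
(`exists_isLeast_spectralAlgebra`). Separability replaces the families `μ^B_φ` and `μ^B_{Pφ}` by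
single finite measures `μ` and `ν` with the same null sets. Then `ν ≪ μ`, and the set where `dν/dμ ≠
0` yields the least spectral projector above `P`.

For a density matrix, `tr(ρP) = 1` is equivalent to `ρP = ρ` (`hasTrace_mul_iff`), and this makes
the three properties of `F` pure algebra. The vector case is the rank-one density matrix. -/

/-! ### Norms and order of projectors -/

theorem Projector.inner_self (P : Projector H) (φ : H) :
    inner ℂ φ (P.1 φ) = ((‖P.1 φ‖ ^ 2 : ℝ) : ℂ) := by
  have h : P.1 (P.1 φ) = P.1 φ := congrArg (fun T : H →L[ℂ] H => T φ) P.2.1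
  rw [← h, ← ContinuousLinearMap.adjoint_inner_left, P.2.2.adjoint_eq, h,
    inner_self_eq_norm_sq_to_K]
  norm_cast

theorem Projector.norm_sub_sq (P : Projector H) (φ : H) :
    ‖φ - P.1 φ‖ ^ 2 = ‖φ‖ ^ 2 - ‖P.1 φ‖ ^ 2 := by
  have h : ‖φ - P.1 φ‖ ^ 2 = _ := @_root_.norm_sub_sq ℂ _ _ _ _ φ (P.1 φ)
  rw [h, P.inner_self, RCLike.re_to_complex, Complex.ofReal_re]
  ring

theorem Projector.le_iff (P Q : Projector H) : P ≤ Q ↔ ∀ φ, Q.1 (P.1 φ) = P.1 φ := by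
  rw [Projector.le_iff_range_le]
  constructor
  · intro h φ
    obtain ⟨χ, hχ⟩ := h ⟨φ, rfl⟩
    change Q.1 χ = P.1 φ at hχ
    rw [← hχ]
    exact congrArg (fun T : H →L[ℂ] H => T χ) Q.2.1
  · rintro h _ ⟨φ, rfl⟩
    exact ⟨P.1 φ, h φ⟩

theorem Projector.le_iff_mul_eq (P Q : Projector H) : P ≤ Q ↔ Q.1 * P.1 = P.1 := by
  rw [Projector.le_iff, ContinuousLinearMap.ext_iff]
  rfl

/-! ### Spectral projectors and null sets of spectral measures -/

namespace Observable

theorem norm_proj_apply_sq (A : Observable H) (Δ : A.BorelSubset) (φ : H) :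
    ‖(A.proj Δ).1 φ‖ ^ 2 = (A.spectralMeasure φ).real Δ.1 := by
  have h := A.inner_borelFun (isBoundedBorel_indicator Δ.2.1) φ
  rw [integral_indicator_one Δ.2.1] at h
  exact_mod_cast ((A.proj Δ).inner_self φ).symm.trans h

theorem norm_sq_eq_spectralMeasure (A : Observable H) (φ : H) :
    ‖φ‖ ^ 2 = (A.spectralMeasure φ).real Set.univ := by
  have h := A.integral_spectralMeasure φ (g := fun _ => 1) continuous_const
  rw [cfc_const_one ℝ A.op A.isSelfAdjoint] at h
  simp only [integral_const, smul_eq_mul, mul_one, one_apply_eq_self,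
    inner_self_eq_norm_sq_to_K] at h
  rw [h]
  norm_cast

theorem proj_apply_eq_zero_iff (A : Observable H) (Δ : A.BorelSubset) (φ : H) :
    (A.proj Δ).1 φ = 0 ↔ A.spectralMeasure φ Δ.1 = 0 := by
  rw [← norm_eq_zero, ← sq_eq_zero_iff, norm_proj_apply_sq, measureReal_eq_zero_iff]

theorem proj_apply_eq_self_iff (A : Observable H) (Δ : A.BorelSubset) (φ : H) :
    (A.proj Δ).1 φ = φ ↔ A.spectralMeasure φ Δ.1ᶜ = 0 := by
  rw [eq_comm, ← sub_eq_zero, ← norm_eq_zero, ← sq_eq_zero_iff, Projector.norm_sub_sq,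
    norm_proj_apply_sq, A.norm_sq_eq_spectralMeasure, ← measureReal_compl Δ.2.1,
    measureReal_eq_zero_iff]

/-- Translates the order into null sets: a vector is fixed by `E[A ∈ Δ]` exactly when its spectral
measure does not charge the complement of `Δ`. -/
theorem le_proj_iff (A : Observable H) (P : Projector H) (Δ : A.BorelSubset) :
    P ≤ A.proj Δ ↔ ∀ φ, A.spectralMeasure (P.1 φ) Δ.1ᶜ = 0 := by
  simp only [Projector.le_iff, proj_apply_eq_self_iff]

theorem proj_le_proj_iff (A : Observable H) (Δ Δ' : A.BorelSubset) :
    A.proj Δ ≤ A.proj Δ' ↔ ∀ φ, A.spectralMeasure φ (Δ.1 \ Δ'.1) = 0 := by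
  constructor
  · intro h φ
    have hd : MeasurableSet (Δ.1 \ Δ'.1) ∧ Δ.1 \ Δ'.1 ⊆ spectrum ℝ A.op :=
      ⟨Δ.2.1.diff Δ'.2.1, Set.sdiff_subset.trans Δ.2.2⟩
    -- `E[D]φ` is fixed by `E[D]`. Being also in the range of `E[Δ']`, it has a spectral measure
    -- that vanishes off `Δ'`, hence on `D`. So it is zero.
    let D : A.BorelSubset := ⟨_, hd⟩
    have hD : A.proj D ≤ A.proj Δ := (A.le_proj_iff _ _).2 fun χ =>
      measure_mono_null (Set.compl_subset_compl.2 Set.sdiff_subset)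
        ((A.le_proj_iff _ _).1 le_rfl χ)
    have h1 := (A.le_proj_iff _ _).1 (hD.trans h) φ
    have h2 := (A.le_proj_iff _ _).1 (le_refl (A.proj D)) φ
    have h3 : A.spectralMeasure ((A.proj D).1 φ) D.1 = 0 :=
      measure_mono_null (fun x hx => hx.2) h1
    rw [← proj_apply_eq_zero_iff] at h3
    rw [← proj_apply_eq_self_iff] at h2
    exact (A.proj_apply_eq_zero_iff D φ).1 (h2.symm.trans h3)
  · intro h
    refine (A.le_proj_iff _ _).2 fun φ => ?_
    refine measure_mono_null (t := Δ.1ᶜ ∪ Δ.1 \ Δ'.1) (fun x hx => ?_)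
      (measure_union_null ((A.le_proj_iff _ _).1 le_rfl φ) (h _))
    by_cases hxΔ : x ∈ Δ.1
    · exact Or.inr ⟨hxΔ, hx⟩
    · exact Or.inl hxΔ

theorem proj_mono (A : Observable H) {Δ Δ' : A.BorelSubset} (h : Δ.1 ⊆ Δ'.1) :
    A.proj Δ ≤ A.proj Δ' :=
  (A.proj_le_proj_iff _ _).2 fun φ => by simp [Set.sdiff_eq_empty.2 h]

theorem proj_emptySubset (A : Observable H) : (A.proj A.emptySubset).1 = 0 := by
  ext φ
  exact (A.proj_apply_eq_zero_iff _ φ).2 measure_empty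

theorem proj_fullSubset (A : Observable H) : (A.proj A.fullSubset).1 = 1 := by
  ext φ
  exact (A.proj_apply_eq_self_iff _ φ).2 (A.spectralMeasure_compl_spectrum φ)

theorem proj_mul_proj_eq_zero (A : Observable H) {Δ Δ' : A.BorelSubset}
    (h : Δ.1 ∩ Δ'.1 = ∅) : (A.proj Δ).1 * (A.proj Δ').1 = 0 := by
  ext φ
  refine (A.proj_apply_eq_zero_iff Δ _).2 (measure_mono_null (t := Δ'.1ᶜ) ?_ ?_)
  · exact fun x hx hx' => Set.eq_empty_iff_forall_notMem.1 h x ⟨hx, hx'⟩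
  · exact (A.le_proj_iff _ _).1 le_rfl φ

/-- The spectral measures of `f(A)` are the push-forwards under `f` of those of `A`, so `E[f(A) ∈
K]` is the projector of `A` for the preimage of `K`, cut down to the spectrum, which changes only a
null set. -/
theorem spectralAlgebra_subset_of_le {A B : Observable H} (h : B ≤ A) :
    B.spectralAlgebra ⊆ A.spectralAlgebra := by
  obtain ⟨f, hf, hB⟩ := h
  rintro _ ⟨K, rfl⟩
  let J : A.BorelSubset := ⟨f ⁻¹' K.1 ∩ spectrum ℝ A.op,
    (hf.1 K.2.1).inter (spectrum.isCompact A.op).measurableSet, Set.inter_subset_right⟩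
  refine ⟨J, Subtype.ext ?_⟩
  refine (B.existsUnique_borelFun (isBoundedBorel_indicator K.2.1)).unique (fun φ => ?_)
    (B.inner_borelFun (isBoundedBorel_indicator K.2.1))
  refine (A.inner_borelFun (isBoundedBorel_indicator J.2.1) φ).trans ?_
  rw [integral_indicator_one J.2.1, integral_indicator_one K.2.1,
    A.spectralMeasure_of_eq_borelFun B hf hB, map_measureReal_apply hf.1 K.2.1]
  congr 1
  refine measureReal_congr ?_
  filter_upwards [A.ae_mem_spectrum φ] with x hx
  exact propext ⟨fun h => h.1, fun h => ⟨h, hx⟩⟩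

/-! ### The least spectral projector above a given projector -/

/-- A finite measure with the same null sets as the family `μ^A_{Tφ}`, `φ` ranging over `H`. -/
theorem exists_isFiniteMeasure_null_iff [TopologicalSpace.SeparableSpace H] (A : Observable H)
    (T : H →L[ℂ] H) : ∃ μ : Measure ℝ, IsFiniteMeasure μ ∧ ∀ K, MeasurableSet K →
      (μ K = 0 ↔ ∀ φ, A.spectralMeasure (T φ) K = 0) := by
  let m : Measure ℝ :=
    Measure.sum fun n => A.spectralMeasure (T (TopologicalSpace.denseSeq H n))
  -- The sum over a dense sequence may be infinite; `toFinite` is a finite measure with the same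
  -- null sets.
  refine ⟨m.toFinite, inferInstance, fun K hK => ?_⟩
  have e : m.toFinite K = 0 ↔ m K = 0 :=
    ⟨fun h => absolutelyContinuous_toFinite m h, fun h => toFinite_absolutelyContinuous m h⟩
  rw [e, Measure.sum_apply _ hK, ENNReal.tsum_eq_zero]
  refine ⟨fun h φ => ?_, fun h n => h _⟩
  let D : A.BorelSubset := ⟨K ∩ spectrum ℝ A.op,
    hK.inter (spectrum.isCompact A.op).measurableSet, Set.inter_subset_right⟩
  have hD : ∀ χ, (A.proj D).1 χ = 0 ↔ A.spectralMeasure χ K = 0 := fun χ => by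
    rw [proj_apply_eq_zero_iff]
    refine ⟨fun h => ?_, fun h => measure_mono_null Set.inter_subset_left h⟩
    refine measure_mono_null (t := D.1 ∪ (spectrum ℝ A.op)ᶜ) (fun x hx => ?_)
      (measure_union_null h (A.spectralMeasure_compl_spectrum χ))
    by_cases hs : x ∈ spectrum ℝ A.op
    · exact Or.inl ⟨hx, hs⟩
    · exact Or.inr hs
  -- Nullity of `K` is the vanishing of a vector that depends continuously on `φ`, so it passes from
  -- the dense sequence to all of `H`.
  have hz : (fun φ => (A.proj D).1 (T φ)) = fun _ => 0 := by
    refine Continuous.ext_on (TopologicalSpace.denseRange_denseSeq H) (by fun_prop)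
      continuous_const ?_
    rintro _ ⟨n, rfl⟩
    exact (hD _).2 (h n)
  exact (hD _).1 (congrFun hz φ)

/-- Among the spectral projectors of `B` that dominate `P` there is a least one. -/
theorem exists_isLeast_spectralAlgebra [TopologicalSpace.SeparableSpace H] (B : Observable H)
    (P : Projector H) : ∃ J : B.BorelSubset,
      IsLeast {Q | Q ∈ B.spectralAlgebra ∧ P ≤ Q} (B.proj J) := by
  obtain ⟨μ, _, hμ⟩ := B.exists_isFiniteMeasure_null_iff (1 : H →L[ℂ] H)
  obtain ⟨ν, _, hν⟩ := B.exists_isFiniteMeasure_null_iff P.1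
  have hac : ν ≪ μ := Measure.AbsolutelyContinuous.mk fun K hK h =>
    (hν K hK).2 fun φ => (hμ K hK).1 h (P.1 φ)
  have hd : ν = μ.withDensity (ν.rnDeriv μ) := (Measure.withDensity_rnDeriv_eq ν μ hac).symm
  have hr : Measurable (ν.rnDeriv μ) := Measure.measurable_rnDeriv ν μ
  have hsp : MeasurableSet (spectrum ℝ B.op) := (spectrum.isCompact B.op).measurableSet
  have hK : MeasurableSet {x | ν.rnDeriv μ x ≠ 0} :=
    (hr (measurableSet_singleton 0)).compl
  -- `J` carries `ν`, so `E[B ∈ J]` dominates `P`; up to `μ`-null sets it is the smallest set that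
  -- does so.
  let J : B.BorelSubset := ⟨{x | ν.rnDeriv μ x ≠ 0} ∩ spectrum ℝ B.op, hK.inter hsp,
    Set.inter_subset_right⟩
  refine ⟨J, ⟨⟨J, rfl⟩, (B.le_proj_iff _ _).2 ((hν _ J.2.1.compl).1 ?_)⟩, ?_⟩
  · rw [Set.compl_inter]
    refine measure_union_null ?_ ((hν _ hsp.compl).2 fun φ => B.spectralMeasure_compl_spectrum _)
    suffices h : μ.withDensity (ν.rnDeriv μ) {x | ν.rnDeriv μ x ≠ 0}ᶜ = 0 by rwa [← hd] at h
    rw [withDensity_apply_eq_zero hr]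
    convert measure_empty (μ := μ)
    exact Set.inter_compl_self _
  · rintro _ ⟨⟨K, rfl⟩, hPK⟩
    -- If `E[B ∈ K]` dominates `P`, the density vanishes `μ`-almost everywhere off `K`. So `J \ K`
    -- is `μ`-null, that is, null for every spectral measure of `B`.
    have h0 : ν K.1ᶜ = 0 := (hν _ K.2.1.compl).2 ((B.le_proj_iff _ _).1 hPK)
    have h1 : μ.withDensity (ν.rnDeriv μ) K.1ᶜ = 0 := by rwa [← hd]
    rw [withDensity_apply_eq_zero hr] at h1
    refine (B.proj_le_proj_iff _ _).2 ((hμ _ (J.2.1.diff K.2.1)).1 ?_)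
    refine measure_mono_null (fun x hx => ?_) h1
    exact ⟨hx.1.1, hx.2⟩

end Observable

/-! ### Coarse-graining along morphisms -/

open Observable

theorem isGLB_coarseGrain {A B : Observable H} (f : B ⟶ A) (P : Projector H) :
    IsGLB {Q | Q ∈ B.spectralAlgebra ∧ P ≤ Q} (coarseGrain f P) :=
  Projector.isGLB_sInf _

theorem coarseGrain_le {A B : Observable H} (f : B ⟶ A) {P Q : Projector H}
    (hQ : Q ∈ B.spectralAlgebra) (hPQ : P ≤ Q) : coarseGrain f P ≤ Q :=
  (isGLB_coarseGrain f P).1 ⟨hQ, hPQ⟩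

theorem le_coarseGrain {A B : Observable H} (f : B ⟶ A) (P : Projector H) :
    P ≤ coarseGrain f P :=
  (isGLB_coarseGrain f P).2 fun _ hQ => hQ.2

theorem coarseGrain_mono {A B : Observable H} (f : B ⟶ A) {P Q : Projector H} (h : P ≤ Q) :
    coarseGrain f P ≤ coarseGrain f Q :=
  (isGLB_coarseGrain f Q).2 fun _ hR => coarseGrain_le f hR.1 (h.trans hR.2)

theorem coarseGrain_eq_self {A B : Observable H} (f : B ⟶ A) {P : Projector H}
    (hP : P ∈ B.spectralAlgebra) : coarseGrain f P = P :=
  le_antisymm (coarseGrain_le f hP le_rfl) (le_coarseGrain f P)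

/-- A least element is also the greatest lower bound among all projectors. The valuation conditions
use separability only through this lemma. -/
theorem coarseGrain_mem_spectralAlgebra [TopologicalSpace.SeparableSpace H]
    {A B : Observable H} (f : B ⟶ A) (P : Projector H) :
    coarseGrain f P ∈ B.spectralAlgebra := by
  obtain ⟨J, hJ⟩ := B.exists_isLeast_spectralAlgebra P
  rw [(isGLB_coarseGrain f P).unique hJ.isGLB]
  exact ⟨J, rfl⟩

theorem coarseGrain_le_coarseGrain_comp {A B C : Observable H} (g : C ⟶ B) (f : B ⟶ A)
    (P : Projector H) : coarseGrain f P ≤ coarseGrain (g ≫ f) P :=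
  (isGLB_coarseGrain (g ≫ f) P).2 fun _ hR =>
    coarseGrain_le f (spectralAlgebra_subset_of_le (leOfHom g) hR.1) hR.2

/-- An `R ∈ W_C` above `P` already lies in `W_B`, so it is also above the first coarse-graining:
both sides are infima over the same upper bounds. Membership of the intermediate infimum in `W_B`
plays no role. -/
theorem coarseGrain_coarseGrain {A B C : Observable H} (g : C ⟶ B) (f : B ⟶ A)
    (P : Projector H) : coarseGrain g (coarseGrain f P) = coarseGrain (g ≫ f) P :=
  le_antisymm
    ((isGLB_coarseGrain (g ≫ f) P).2 fun _ hR => coarseGrain_le g hR.1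
      (coarseGrain_le f (spectralAlgebra_subset_of_le (leOfHom g) hR.1) hR.2))
    (coarseGrain_mono g (le_coarseGrain f P))

/-! ### Certainty sets and their valuations -/

/-- A set of projectors that can serve as the set of propositions made certain by a state. -/
structure IsCertaintySet (F : Set (Projector H)) : Prop where
  mem_of_le : ∀ {P Q : Projector H}, P ∈ F → P ≤ Q → Q ∈ F
  one_mem : ∀ {P : Projector H}, P.1 = 1 → P ∈ F
  mul_ne_zero : ∀ {P Q : Projector H}, P ∈ F → Q ∈ F → P.1 * Q.1 ≠ 0

/-- The sieve of all coarse-grainings of `P` that are certain. -/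
def certaintySieve {F : Set (Projector H)} (hF : IsCertaintySet F) (A : Observable H)
    (P : A.spectralAlgebra) : Sieve A where
  arrows _ f := coarseGrain f P.1 ∈ F
  downward_closed h g := hF.mem_of_le h (coarseGrain_le_coarseGrain_comp g _ _)

/-- A sieve is maximal when it contains the identity, and coarse-graining along the identity fixes
every element of `W_A`. Exclusivity and the unit condition thereby become statements about `F`. -/
theorem certaintySieve_eq_top_iff {F : Set (Projector H)} (hF : IsCertaintySet F)
    (A : Observable H) (P : A.spectralAlgebra) : certaintySieve hF A P = ⊤ ↔ P.1 ∈ F := by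
  rw [← Sieve.id_mem_iff_eq_top]
  change coarseGrain (𝟙 A) P.1 ∈ F ↔ P.1 ∈ F
  rw [coarseGrain_eq_self _ P.2]

theorem isContextualValuation_certaintySieve [TopologicalSpace.SeparableSpace H]
    {F : Set (Projector H)} (hF : IsCertaintySet F) :
    IsContextualValuation (certaintySieve hF) where
  functional_composition {A B} h P := by
    refine ⟨coarseGrain_mem_spectralAlgebra h P.1, Sieve.ext fun C g => ?_⟩
    change coarseGrain g (coarseGrain h P.1) ∈ F ↔ coarseGrain (g ≫ h) P.1 ∈ F
    rw [coarseGrain_coarseGrain]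
  null A P hP := by
    refine le_bot_iff.1 fun B f hf => ?_
    -- An arrow in the sieve would put `0 = E[B ∈ ∅]` into `F`, against `0 * 0 = 0`.
    have hle : P.1 ≤ B.proj B.emptySubset := by
      rw [Projector.le_iff_mul_eq, hP, mul_zero]
    have h0 := hF.mem_of_le hf (coarseGrain_le f ⟨_, rfl⟩ hle)
    exact (hF.mul_ne_zero h0 h0 (by rw [proj_emptySubset, mul_zero])).elim
  monotone A P Q h B f hf := hF.mem_of_le hf (coarseGrain_mono f h)
  exclusive A P Q h hP := by
    rw [certaintySieve_eq_top_iff] at hP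
    rw [lt_top_iff_ne_top, Ne, certaintySieve_eq_top_iff]
    exact fun hQ => hF.mul_ne_zero hP hQ h

theorem contextualUnitCondition_certaintySieve {F : Set (Projector H)}
    (hF : IsCertaintySet F) : ContextualUnitCondition (certaintySieve hF) :=
  fun A P hP => (certaintySieve_eq_top_iff hF A P).2 (hF.one_mem hP)

/-- The propositional conditions are the contextual ones evaluated at spectral projectors: inclusion
of sets gives `≤`, disjointness gives product zero. Independence of the choice of `J` is automatic,
since the value is a function of the projector. -/
theorem IsContextualValuation.isGeneralizedValuation
    {ν : ∀ A : Observable H, A.spectralAlgebra → Sieve A} (hν : IsContextualValuation ν) :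
    IsGeneralizedValuation (fun A Δ => ν A (A.specProj Δ)) where
  functional_composition {A B} h Δ := by
    obtain ⟨hP, hfc⟩ := hν.functional_composition h (A.specProj Δ)
    refine ⟨hP, fun J hJ => ?_⟩
    rw [← hfc]
    exact congrArg (ν B) (Subtype.ext hJ)
  null A := hν.null A _ A.proj_emptySubset
  monotone A _ _ h := hν.monotone A _ _ (A.proj_mono h)
  exclusive A _ _ h := hν.exclusive A _ _ (A.proj_mul_proj_eq_zero h)

theorem ContextualUnitCondition.unitCondition
    {ν : ∀ A : Observable H, A.spectralAlgebra → Sieve A} (hν : ContextualUnitCondition ν) :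
    UnitCondition (fun A Δ => ν A (A.specProj Δ)) :=
  fun A => hν A _ A.proj_fullSubset

/-! ### The trace condition for density matrices -/

/-- Write `T = S⋆S`; then `⟨x, Tx⟩ = ‖Sx‖²`. -/
theorem apply_eq_zero_of_inner_eq_zero {T : H →L[ℂ] H} (hT : T.IsPositive) {x : H}
    (hx : inner ℂ x (T x) = 0) : T x = 0 := by
  rw [← ContinuousLinearMap.nonneg_iff_isPositive] at hT
  obtain ⟨S, rfl⟩ := CStarAlgebra.nonneg_iff_eq_star_mul_self.1 hT
  have h : S x = 0 := by
    rw [← inner_self_eq_zero (𝕜 := ℂ), ← ContinuousLinearMap.adjoint_inner_right]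
    exact hx
  change (star S) (S x) = 0
  rw [h, map_zero]

/-- Every projector has a Hilbert basis of eigenvectors. -/
theorem Projector.exists_hilbertBasis (P : Projector H) : ∃ (w : Set H)
    (b : HilbertBasis w ℂ H), ∀ i, P.1 (b i) = 0 ∨ P.1 (b i) = b i := by
  let V : Submodule ℂ H := P.1.ker
  have hV : IsClosed (V : Set H) := P.1.isClosed_ker
  have : CompleteSpace V := hV.completeSpace_coe
  obtain ⟨s, c, hc⟩ := _root_.exists_hilbertBasis ℂ V
  have ho : Orthonormal ℂ (fun i : s => ((c i : V) : H)) :=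
    c.orthonormal.comp_linearIsometry V.subtypeₗᵢ
  -- A basis of the kernel is extended to one of `H`. Its index set is a subset of `H`, hence in the
  -- universe over which `HasTrace` quantifies.
  obtain ⟨w, b, hw, hb⟩ := ho.toSubtypeRange.exists_hilbertBasis_extension
  refine ⟨w, b, fun i => ?_⟩
  by_cases hi : (i : H) ∈ Set.range (fun i : s => ((c i : V) : H))
  · obtain ⟨j, hj⟩ := hi
    left
    rw [hb, ← hj]
    exact (c j).2
  · right
    -- For an added vector `i`, the difference `i - P i` lies in the kernel and is orthogonal to the
    -- basis of the kernel, so it vanishes.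
    have hPi : P.1 ((i : H) - P.1 i) = 0 := by
      rw [map_sub, sub_eq_zero]
      exact (congrArg (fun T : H →L[ℂ] H => T (i : H)) P.2.1).symm
    let v : V := ⟨(i : H) - P.1 i, hPi⟩
    have hv : v = 0 := by
      have hz : ∀ j, inner ℂ (c j) v = 0 := fun j => by
        rw [Submodule.coe_inner]
        have hji : inner ℂ ((c j : V) : H) (i : H) = 0 := by
          have hmem : ((c j : V) : H) ∈ w := hw ⟨j, rfl⟩
          have := b.orthonormal.2 (i := ⟨_, hmem⟩) (j := i) fun he => hi ⟨j, by rw [← he]⟩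
          simpa [hb] using this
        have hjP : inner ℂ ((c j : V) : H) (P.1 i) = 0 := by
          rw [← ContinuousLinearMap.adjoint_inner_left, P.2.2.adjoint_eq,
            show P.1 ((c j : V) : H) = 0 from (c j).2, inner_zero_left]
        change inner ℂ ((c j : V) : H) ((i : H) - P.1 i) = 0
        rw [inner_sub_right, hji, hjP, sub_zero]
      have := c.hasSum_inner_mul_inner v v
      simp only [hz, mul_zero] at this
      exact inner_self_eq_zero.1 (this.unique hasSum_zero)
    rw [hb]
    exact (sub_eq_zero.1 (congrArg Subtype.val hv)).symm

-- In an eigenbasis of `P`, `tr ρ - tr(ρP)` is the sum of the non-negative numbers `⟨b, ρb⟩` over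
-- the basis vectors killed by `P`. If it is zero, positivity forces `ρb = 0` there, so `ρP` and `ρ`
-- agree on the basis.
open scoped Classical ComplexOrder in
theorem DensityMatrix.hasTrace_mul_iff (ρ : DensityMatrix H) (P : Projector H) :
    HasTrace (ρ.op * P.1) 1 ↔ ρ.op * P.1 = ρ.op := by
  refine ⟨fun h => ?_, fun h => by rw [h]; exact ρ.trace_one⟩
  obtain ⟨w, b, hb⟩ := P.exists_hilbertBasis
  have h1 := (ρ.trace_one w b).sub (h w b)
  rw [sub_self] at h1
  have hterm : ∀ i, inner ℂ (b i) (ρ.op (b i)) - inner ℂ (b i) ((ρ.op * P.1) (b i)) =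
      if P.1 (b i) = 0 then inner ℂ (b i) (ρ.op (b i)) else 0 := fun i => by
    change inner ℂ (b i) (ρ.op (b i)) - inner ℂ (b i) (ρ.op (P.1 (b i))) = _
    split_ifs with h0
    · rw [h0, map_zero, inner_zero_right, sub_zero]
    · rw [(hb i).resolve_left h0, sub_self]
  have hnn : ∀ i, 0 ≤ inner ℂ (b i) (ρ.op (b i)) - inner ℂ (b i) ((ρ.op * P.1) (b i)) :=
    fun i => by
      rw [hterm]
      split_ifs
      · exact ρ.isPositive.inner_nonneg_right _
      · exact le_rfl
  have hz := (hasSum_zero_iff_of_nonneg hnn).1 h1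
  refine ContinuousLinearMap.ext_on (s := Set.range b) ?_ ?_
  · exact Submodule.dense_iff_topologicalClosure_eq_top.2 b.dense_span
  · rintro _ ⟨i, rfl⟩
    change ρ.op (P.1 (b i)) = ρ.op (b i)
    rcases hb i with h0 | h0
    · have := congrFun hz i
      rw [hterm, if_pos h0] at this
      rw [h0, map_zero, apply_eq_zero_of_inner_eq_zero ρ.isPositive this]
    · rw [h0]

theorem DensityMatrix.op_ne_zero (ρ : DensityMatrix H) : ρ.op ≠ 0 := by
  intro h
  obtain ⟨w, b, -⟩ := _root_.exists_hilbertBasis ℂ H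
  have := ρ.trace_one w b
  simp only [h, zero_apply, inner_zero_right] at this
  exact zero_ne_one (hasSum_zero.unique this)

theorem DensityMatrix.isCertaintySet (ρ : DensityMatrix H) :
    IsCertaintySet {P : Projector H | HasTrace (ρ.op * P.1) 1} where
  mem_of_le {P Q} hP hPQ := by
    rw [Set.mem_ofPred_eq, hasTrace_mul_iff] at hP ⊢
    rw [Projector.le_iff_mul_eq] at hPQ
    -- The adjoint of `QP = P` is `PQ = P`, whence `ρQ = ρPQ = ρP = ρ`.
    have h := congrArg star hPQ
    rw [star_mul, P.2.2.star_eq, Q.2.2.star_eq] at h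
    rw [← hP, mul_assoc, h]
  one_mem {P} hP := by
    rw [Set.mem_ofPred_eq, hP, mul_one]
    exact ρ.trace_one
  mul_ne_zero {P Q} hP hQ h := by
    rw [Set.mem_ofPred_eq, hasTrace_mul_iff] at hP hQ
    -- `ρ = ρQ = ρPQ = 0` contradicts trace one.
    exact ρ.op_ne_zero (by rw [← hQ, ← hP, mul_assoc, h, mul_zero])

/-! ### Pure states and the conclusion -/

/-- The density matrix `‖ψ‖⁻² |ψ⟩⟨ψ|` of a non-zero vector. -/
noncomputable def DensityMatrix.pure (ψ : H) (hψ : ψ ≠ 0) : DensityMatrix H where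
  op := ((‖ψ‖ : ℂ) ^ 2)⁻¹ • InnerProductSpace.rankOne ℂ ψ ψ
  isPositive := by
    refine (InnerProductSpace.isPositive_rankOne_self ψ).smul_of_nonneg ?_
    rw [← Complex.ofReal_pow, ← Complex.ofReal_inv, Complex.zero_le_real]
    positivity
  trace_one ι b := by
    -- The trace is Parseval's identity for `ψ`, divided by `‖ψ‖²`.
    have h := (b.hasSum_inner_mul_inner ψ ψ).mul_left ((‖ψ‖ : ℂ) ^ 2)⁻¹
    have hn : (‖ψ‖ : ℂ) ^ 2 ≠ 0 := by simpa using hψ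
    rw [inner_self_eq_norm_sq_to_K] at h
    erw [inv_mul_cancel₀ hn] at h
    refine h.congr_fun fun i => ?_
    simp

/-- For the rank-one `ρ`, the equation `ρP = ρ` says `⟨Pψ, x⟩ = ⟨ψ, x⟩` for all `x`, after
cancelling the scalar and the non-zero vector `ψ`. -/
theorem DensityMatrix.hasTrace_pure_mul_iff {ψ : H} (hψ : ψ ≠ 0) (P : Projector H) :
    HasTrace ((DensityMatrix.pure ψ hψ).op * P.1) 1 ↔ P.1 ψ = ψ := by
  have hn : ((‖ψ‖ : ℂ) ^ 2)⁻¹ ≠ 0 := by simpa using hψ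
  have hsym : ∀ x, inner ℂ ψ (P.1 x) = inner ℂ (P.1 ψ) x := fun x => by
    rw [← ContinuousLinearMap.adjoint_inner_left, P.2.2.adjoint_eq]
  have e : ∀ x, (DensityMatrix.pure ψ hψ).op x =
    ((‖ψ‖ : ℂ) ^ 2)⁻¹ • (inner ℂ ψ x • ψ) := fun x => rfl
  rw [hasTrace_mul_iff, ContinuousLinearMap.ext_iff]
  constructor
  · refine fun h => ext_inner_right ℂ fun x => ?_
    have hx := h x
    rw [mul_apply_eq_comp, e, e] at hx
    rw [← hsym]
    exact smul_left_injective ℂ hψ (smul_right_injective H hn hx)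
  · intro h x
    rw [mul_apply_eq_comp, e, e, hsym, h]

end GenVal

theorem mainTheorem1 {H : Type*} [NormedAddCommGroup H] [InnerProductSpace ℂ H] [CompleteSpace H]
    [TopologicalSpace.SeparableSpace H] :
    (∀ ρ : DensityMatrix H, ∃ ν : ∀ A : Observable H, A.spectralAlgebra → Sieve A,
      (∀ (A : Observable H) (Δ : A.BorelSubset),
        (ν A (A.specProj Δ)).arrows = densityArrows ρ A Δ) ∧
      IsGeneralizedValuation (fun A Δ => ν A (A.specProj Δ)) ∧
      UnitCondition (fun A Δ => ν A (A.specProj Δ)) ∧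
      IsContextualValuation ν ∧ ContextualUnitCondition ν) ∧
    (∀ ψ : H, ψ ≠ 0 → ∃ ν : ∀ A : Observable H, A.spectralAlgebra → Sieve A,
      (∀ (A : Observable H) (Δ : A.BorelSubset),
        (ν A (A.specProj Δ)).arrows = vectorArrows ψ A Δ) ∧
      IsGeneralizedValuation (fun A Δ => ν A (A.specProj Δ)) ∧
      UnitCondition (fun A Δ => ν A (A.specProj Δ)) ∧
      IsContextualValuation ν ∧ ContextualUnitCondition ν ∧
      ∃ ρ : DensityMatrix H,
        ρ.op = ((‖ψ‖ : ℂ) ^ 2)⁻¹ • InnerProductSpace.rankOne ℂ ψ ψ ∧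
        ∀ (A : Observable H) (Δ : A.BorelSubset),
          densityArrows ρ A Δ = vectorArrows ψ A Δ) := by
  have density : ∀ ρ : DensityMatrix H, ∃ ν : ∀ A : Observable H, A.spectralAlgebra → Sieve A,
      (∀ (A : Observable H) (Δ : A.BorelSubset),
        (ν A (A.specProj Δ)).arrows = densityArrows ρ A Δ) ∧
      IsGeneralizedValuation (fun A Δ => ν A (A.specProj Δ)) ∧
      UnitCondition (fun A Δ => ν A (A.specProj Δ)) ∧
      IsContextualValuation ν ∧ ContextualUnitCondition ν := fun ρ =>
    have hν := isContextualValuation_certaintySieve ρ.isCertaintySet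
    have hu := contextualUnitCondition_certaintySieve ρ.isCertaintySet
    ⟨certaintySieve ρ.isCertaintySet, fun _ _ => rfl, hν.isGeneralizedValuation,
      hu.unitCondition, hν, hu⟩
  refine ⟨density, fun ψ hψ => ?_⟩
  have harrows : ∀ (A : Observable H) (Δ : A.BorelSubset),
      densityArrows (DensityMatrix.pure ψ hψ) A Δ = vectorArrows ψ A Δ := fun A Δ => by
    funext B f
    exact propext (DensityMatrix.hasTrace_pure_mul_iff hψ _)
  -- The two collections of arrows coincide, so the valuation of the pure density matrix serves for
  -- `ψ`.
  obtain ⟨ν, hν, hg, hu, hc, hcu⟩ := density (DensityMatrix.pure ψ hψ)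
  exact ⟨ν, fun A Δ => (hν A Δ).trans (harrows A Δ), hg, hu, hc, hcu,
    DensityMatrix.pure ψ hψ, rfl, harrows⟩
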